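/- Let $(M,d)$ be a metric space. A configuration of a family of servers assigns to each server a point of $M$. Given an initial configuration and a finite sequence $\sigma=(\sigma_1,\dots,\sigma_m)$ of points of $M$ (requests), a schedule serving $\sigma$ is a sequence of configurations, starting with the initial one, such that after step $j$ some server is located at $\sigma_j$; its cost is the total distance travelled by all servers, and the optimal offline cost $\mathrm{OPT}(\sigma)$ is the infimum of the costs of all schedules serving $\sigma$. A (deterministic) online algorithm determines the configuration after step $j$ from $\sigma_1,\dots,\sigma_j$ only and serves every $\sigma$; its cost is $\mathrm{ALG}(\sigma)$. It is $\rho$-competitive ($1\le\rho<\infty$) if there is a constant $c$ with $\mathrm{ALG}(\sigma)\le\rho\,\mathrm{OPT}(\sigma)+c$ for all $\sigma$. In the infinite server problem on $(M,s)$, $s\in M$, both the online and the offline algorithm have countably infinitely many servers, all starting at $s$; the problem is competitive if for some $\rho$ it admits a $\rho$-competitive online algorithm. In the $(h,k)$-server problem on $M$ the online algorithm has $k$ servers and the offline algorithm has $h$ servers; it is $\rho$-competitive if for all initial configurations of the online and the offline servers there is a $\rho$-competitive online algorithm ($c$ may depend on the initial configurations, $\rho$ may not). **Theorem.** The following are equivalent: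 1. For every metric space $M$ and every $s\in M$, the infinite server problem on $(M,s)$ is competitive. 2. On every metric space, the $(h,k)$-server problem is $O(1)$-competitive as $k/h\to\infty$; that is, there are a constant $\rho$ and a function $k=k(h)$ with $k(h)/h\to\infty$ as $h\to\infty$ such that for every $h\ge1$ the $(h,k(h))$-server problem is $\rho$-competitive. 3. On every metric space, for each $h\ge 1$ there is $k=O(h)$ so that the $(h,k)$-server problem is $O(1)$-competitive; that is, there are a constant $\rho$ and a function $k=k(h)$ with $k(h)=O(h)$ such that for every $h\ge1$ the $(h,k(h))$-server problem is $\rho$-competitive. Here, in each of (2) and (3), it is equivalent to let $\rho$ and the function $k$ depend on the metric space or to require them to be the same for all metric spaces. The three statements are also equivalent if the metric space is fixed to be the real line, that is, the following are equivalent: (1') for every $s\in\mathbb R$, the infinite server problem on $(\mathbb R,s)$ is competitive; (2') there are $\rho$ and $k(h)$ as in (2) for the $(h,k)$-server problem on $\mathbb R$; (3') there are $\rho$ and $k(h)$ as in (3) for the $(h,k)$-server problem on $\mathbb R$. -/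

import Mathlib

open scoped NNReal ENNReal
open Filter

universe u

namespace ServerProblem

/-- `Serves a σ c`: the sequence of configurations `c 0, c 1, …` of labelled servers (with labels in
`S`) starts in the configuration `a`, and some server is at the `j`-th request of `σ` right after
the `j`-th step. Only `c 0, …, c σ.length` matter. -/
def Serves {M S : Type*} (a : S → M) (σ : List M) (c : ℕ → S → M) : Prop :=
  c 0 = a ∧ ∀ (j : ℕ) (hj : j < σ.length), ∃ i : S, c (j + 1) i = σ[j]

/-- The total distance travelled by all servers during the first `n` steps. -/
noncomputable def travel {M S : Type*} [MetricSpace M] (n : ℕ) (c : ℕ → S → M) : ℝ≥0∞ :=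
  ∑ j ∈ Finset.range n, ∑' i : S, edist (c j i) (c (j + 1) i)

/-- The optimal offline cost of serving `σ` from the initial configuration `b`. -/
noncomputable def opt {M T : Type*} [MetricSpace M] (b : T → M) (σ : List M) : ℝ≥0∞ :=
  ⨅ (c : ℕ → T → M) (_ : Serves b σ c), travel σ.length c

/-- A deterministic online algorithm maps the list of requests seen so far to the current
configuration. This is the sequence of configurations that it produces on `σ`. -/
def run {M S : Type*} (alg : List M → S → M) (σ : List M) : ℕ → S → M :=
  fun j => alg (σ.take j)

/-- `alg` is a correct online algorithm starting in the configuration `a`. -/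
def IsOnlineAlgorithm {M S : Type*} (a : S → M) (alg : List M → S → M) : Prop :=
  ∀ σ : List M, Serves a σ (run alg σ)

/-- There is a `ρ`-competitive deterministic online algorithm with servers `S` starting in `a`,
against offline algorithms with servers `T` starting in `b`. -/
def IsCompetitive {M S T : Type*} [MetricSpace M] (a : S → M) (b : T → M) (ρ : ℝ≥0) : Prop :=
  1 ≤ ρ ∧ ∃ alg : List M → S → M, IsOnlineAlgorithm a alg ∧
    ∃ c : ℝ≥0, ∀ σ : List M, travel σ.length (run alg σ) ≤ ρ * opt b σ + c

/-- The infinite server problem on `(M, s)` is competitive. -/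
def InfiniteServerCompetitive (M : Type*) [MetricSpace M] (s : M) : Prop :=
  ∃ ρ : ℝ≥0, IsCompetitive (fun _ : ℕ => s) (fun _ : ℕ => s) ρ

/-- The `(h, k)`-server problem on `M` is `ρ`-competitive, for all initial configurations of the
`k` online and the `h` offline servers; the additive constant may depend on these. -/
def HKServerCompetitive (M : Type*) [MetricSpace M] (h k : ℕ) (ρ : ℝ≥0) : Prop :=
  ∀ (a : Fin k → M) (b : Fin h → M), IsCompetitive a b ρ

/-- `P h k ρ` stands for "the `(h, k)`-server problem is `ρ`-competitive".
The problem is `O(1)`-competitive as `k / h → ∞`: this holds for some function `k` of `h` with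
`k h / h → ∞`, with one ratio `ρ` for all `h ≥ 1`. -/
def BoundedAsRatioTendsToInfinity (P : ℕ → ℕ → ℝ≥0 → Prop) : Prop :=
  ∃ (ρ : ℝ≥0) (k : ℕ → ℕ), Tendsto (fun h : ℕ => (k h : ℝ) / (h : ℝ)) atTop atTop ∧
    ∀ h : ℕ, 1 ≤ h → P h (k h) ρ

/-- For each `h ≥ 1` there is `k = O(h)` so that the `(h, k)`-server problem is
`O(1)`-competitive. -/
def BoundedForLinear (P : ℕ → ℕ → ℝ≥0 → Prop) : Prop :=
  ∃ (ρ : ℝ≥0) (k : ℕ → ℕ),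
    Asymptotics.IsBigO atTop (fun h : ℕ => (k h : ℝ)) (fun h : ℕ => (h : ℝ)) ∧
    ∀ h : ℕ, 1 ≤ h → P h (k h) ρ

end ServerProblem

/-!
All equivalences rest on three constructions.

**From the infinite server problem to `k = O(h)`.** Suppose the optimal cost of `h` servers starting
at `o` is guessed to be `h * R`. Play the infinite server problem on `M × ℝ` (maximum metric) with
source `(o, 0)`, sending a request `x` to `(x, R)`. The `h` offline servers reach the level `R` at
cost `h * R`, so if the guess is large enough, the online cost is `O(h * R)`; since every server
that leaves the source pays at least `R`, only `O(h)` servers are used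
(`hasGuessingAlgorithms_of_games`). The guess is doubled whenever its budget is exceeded, and the
costs of the rejected guesses form a geometric sum (`HasGuessingAlgorithms.isCompetitive`). On the
line, the two half-lines starting at `o` are treated as two games with source `0`. The competitive
ratio and the additive constant are uniform over all metric spaces, because otherwise a wedge of
counterexamples would not be competitive (`exists_uniform_lazy`).

**From `k = O(h)` to `k / h → ∞`.** Additional servers stay put (`HKServerCompetitive.mono`).

**From the `(h, k)`-server problem to the infinite server problem.** Only the existence of some `k`
for every `h`, with a common ratio `ρ`, is needed. Compare the online cost with `ρ` times the
offline cost including the return of all offline servers to `s`. After a history that nearly maximizes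
the difference, the additive constant is negligible (`exists_history_runCost_le`), and serving `σ` and
returning costs at most twice the optimal cost of `σ`. At this moment the `k` online servers may be
anywhere, but if the space contains many copies of `(M, s)` with a common base point, some copy has
no server in it (`HasVacantCopies`): there, the servers are no better placed than at `s`. Suitable
spaces are an infinite wedge of copies of `(M, s)` and, for finitely many requests on the line,
the line itself with its homothetic copies at very different scales. This gives, for every `h` and
every finite set of requests, an algorithm with infinitely many servers at `s` that is good for
request sequences of length at most `h`. Numbering the servers in the order of first use leaves
finitely many choices at each step, so an ultrafilter limit of these algorithms exists, and it is
good for all sequences (`exists_lazy_limit`).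

Online algorithms read histories, which are lists of requests with the most recent request first.
Lazy algorithms move just one server per request, to that request.
-/

namespace ServerProblem

/-! ### Histories and the cost of an online algorithm -/

/-- The total distance between two configurations, server by server. -/
noncomputable def confDist {M S : Type*} [MetricSpace M] (p q : S → M) : ℝ≥0∞ :=
  ∑' i : S, edist (p i) (q i)

lemma confDist_self {M S : Type*} [MetricSpace M] (p : S → M) : confDist p p = 0 := by
  simp [confDist]

lemma confDist_comm {M S : Type*} [MetricSpace M] (p q : S → M) :
    confDist p q = confDist q p := by
  simp only [confDist, edist_comm]

lemma confDist_triangle {M S : Type*} [MetricSpace M] (p q r : S → M) :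
    confDist p r ≤ confDist p q + confDist q r := by
  unfold confDist
  rw [← ENNReal.tsum_add]
  exact ENNReal.tsum_le_tsum fun i => edist_triangle _ _ _

lemma confDist_comp_le {M S S' : Type*} [MetricSpace M] (p q : S → M) {e : S' → S}
    (he : Function.Injective e) : confDist (p ∘ e) (q ∘ e) ≤ confDist p q :=
  ENNReal.tsum_comp_le_tsum_of_injective he (fun i => edist (p i) (q i))

lemma confDist_lipschitz_le {M N S : Type*} [MetricSpace M] [MetricSpace N] {K : ℝ≥0} {f : M → N}
    (hf : LipschitzWith K f) (p q : S → M) :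
    confDist (f ∘ p) (f ∘ q) ≤ K * confDist p q := by
  unfold confDist
  rw [← ENNReal.tsum_mul_left]
  exact ENNReal.tsum_le_tsum fun i => hf _ _

lemma confDist_extend {M S S' : Type*} [MetricSpace M] {e : S → S'}
    (he : Function.Injective e) (p q : S → M) (b : S' → M) :
    confDist (Function.extend e p b) (Function.extend e q b) = confDist p q := by
  unfold confDist
  have hs : Function.support
      (fun i => edist (Function.extend e p b i) (Function.extend e q b i)) ⊆ Set.range e := by
    intro i hi
    by_contra h
    have h' : ¬ ∃ t, e t = i := h
    simp [Function.extend_apply' _ _ _ h'] at hi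
  rw [← he.tsum_eq hs]
  simp [he.extend_apply]

lemma confDist_fin_ne_top {M : Type*} [MetricSpace M] {k : ℕ} (p q : Fin k → M) :
    confDist p q ≠ ⊤ := by
  unfold confDist
  rw [tsum_fintype]
  exact ENNReal.sum_ne_top.2 fun i _ => edist_ne_top _ _

/-- The cost of an online algorithm that reads histories, that is, request sequences listed with the
most recent request first. -/
noncomputable def runCost {M S : Type*} [MetricSpace M] (alg : List M → S → M) : List M → ℝ≥0∞
  | [] => 0
  | x :: τ => runCost alg τ + confDist (alg τ) (alg (x :: τ))

/-- A correct online algorithm starting in `a`, reading histories with the most recent request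
first. -/
structure IsHistoryAlgorithm {M S : Type*} (a : S → M) (alg : List M → S → M) : Prop where
  nil : alg [] = a
  serves : ∀ (x : M) (τ : List M), ∃ i, alg (x :: τ) i = x

lemma confDist_le_runCost {M S : Type*} [MetricSpace M] (alg : List M → S → M) (τ : List M) :
    confDist (alg []) (alg τ) ≤ runCost alg τ := by
  induction τ with
  | nil => simp [runCost, confDist_self]
  | cons x τ ih =>
    exact (confDist_triangle _ (alg τ) _).trans (by rw [runCost]; gcongr)

lemma runCost_append {M S : Type*} [MetricSpace M] (alg : List M → S → M) (τ₀ τ : List M) :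
    runCost alg (τ ++ τ₀) = runCost alg τ₀ + runCost (fun τ' => alg (τ' ++ τ₀)) τ := by
  induction τ with
  | nil => simp [runCost]
  | cons x τ ih => simp [runCost, ih, add_assoc]

lemma travel_eq_sum_confDist {M S : Type*} [MetricSpace M] (n : ℕ) (c : ℕ → S → M) :
    travel n c = ∑ j ∈ Finset.range n, confDist (c j) (c (j + 1)) := rfl

lemma travel_run {M S : Type*} [MetricSpace M] (alg : List M → S → M) (σ : List M) :
    travel σ.length (run alg σ) = runCost (fun τ => alg τ.reverse) σ.reverse := by
  induction σ using List.reverseRecOn with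
  | nil => simp [travel, runCost]
  | append_singleton σ x ih =>
    rw [List.reverse_append, List.reverse_singleton, List.singleton_append, runCost, ← ih,
      List.length_append, List.length_singleton, travel_eq_sum_confDist, Finset.sum_range_succ,
      travel_eq_sum_confDist]
    congr 1
    · refine Finset.sum_congr rfl fun j hj => ?_
      have hj := Finset.mem_range.1 hj
      simp only [run]
      rw [List.take_append_of_le_length hj.le, List.take_append_of_le_length hj]
    · simp [run, List.take_of_length_le]

lemma IsHistoryAlgorithm.serves_run {M S : Type*} {a : S → M} {alg : List M → S → M}
    (h : IsHistoryAlgorithm a alg) (σ : List M) :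
    Serves a σ (run (fun σ => alg σ.reverse) σ) := by
  refine ⟨by simp [run, h.nil], fun j hj => ?_⟩
  obtain ⟨i, hi⟩ := h.serves σ[j] (σ.take j).reverse
  refine ⟨i, ?_⟩
  have h' : (σ.take (j + 1)).reverse = σ[j] :: (σ.take j).reverse := by
    rw [List.take_succ_eq_append_getElem hj]
    simp
  simpa only [run, h'] using hi

lemma isCompetitive_of_history {M S T : Type*} [MetricSpace M] {a : S → M} {b : T → M} {ρ : ℝ≥0}
    (hρ : 1 ≤ ρ) {alg : List M → S → M} (h : IsHistoryAlgorithm a alg) {c : ℝ≥0}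
    (hc : ∀ τ : List M, runCost alg τ ≤ ρ * opt b τ.reverse + c) : IsCompetitive a b ρ := by
  refine ⟨hρ, fun σ => alg σ.reverse, h.serves_run, c, fun σ => ?_⟩
  rw [travel_run]
  simpa using hc σ.reverse

lemma IsCompetitive.exists_history {M S T : Type*} [MetricSpace M] {a : S → M} {b : T → M}
    {ρ : ℝ≥0} (h : IsCompetitive a b ρ) :
    ∃ alg : List M → S → M, IsHistoryAlgorithm a alg ∧
      ∃ c : ℝ≥0, ∀ τ : List M, runCost alg τ ≤ ρ * opt b τ.reverse + c := by
  obtain ⟨-, alg, halg, c, hc⟩ := h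
  refine ⟨fun τ => alg τ.reverse, ⟨?_, fun x τ => ?_⟩, c, fun τ => ?_⟩
  · simpa [run] using (halg []).1
  · obtain ⟨i, hi⟩ := (halg (x :: τ).reverse).2 τ.length (by simp)
    refine ⟨i, ?_⟩
    simpa [run, List.take_of_length_le] using hi
  · have := hc τ.reverse
    rwa [travel_run, List.reverse_reverse] at this

/-! ### Offline schedules -/

lemma opt_le_travel {M T : Type*} [MetricSpace M] {b : T → M} {σ : List M} {c : ℕ → T → M}
    (hc : Serves b σ c) : opt b σ ≤ travel σ.length c :=
  iInf₂_le c hc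

lemma opt_le_runCost {M T : Type*} [MetricSpace M] {b : T → M} {alg : List M → T → M}
    (h : IsHistoryAlgorithm b alg) (τ : List M) : opt b τ.reverse ≤ runCost alg τ := by
  refine (opt_le_travel (h.serves_run _)).trans ?_
  rw [travel_run]
  simp

lemma le_add_mul_opt {M T : Type*} [MetricSpace M] {b : T → M} {σ : List M} {A B : ℝ≥0∞} {K : ℝ≥0}
    (hK : K ≠ 0) (h : ∀ c, Serves b σ c → B ≤ A + K * travel σ.length c) :
    B ≤ A + K * opt b σ := by
  unfold opt
  rw [ENNReal.mul_iInf_of_ne (by simpa using hK) ENNReal.coe_ne_top, ENNReal.add_iInf]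
  refine le_iInf fun c => ?_
  rw [ENNReal.mul_iInf_of_ne (by simpa using hK) ENNReal.coe_ne_top, ENNReal.add_iInf]
  exact le_iInf fun hc => h c hc

/-- Changing the configuration at time `0` costs at most the distance between the two. -/
lemma travel_change_start_le {M T : Type*} [MetricSpace M] (b : T → M) (n : ℕ) (c : ℕ → T → M) :
    travel n (fun j => if j = 0 then b else c j) ≤ confDist b (c 0) + travel n c := by
  cases n with
  | zero => simp [travel]
  | succ n =>
    simp only [travel_eq_sum_confDist]
    rw [Finset.sum_range_succ', Finset.sum_range_succ' (fun j => confDist (c j) (c (j + 1)))]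
    simp only [Nat.add_eq_zero_iff, one_ne_zero, and_false, if_false, if_true]
    have := confDist_triangle b (c 0) (c (0 + 1))
    calc _ ≤ ∑ k ∈ Finset.range n, confDist (c (k + 1)) (c (k + 1 + 1)) +
          (confDist b (c 0) + confDist (c 0) (c (0 + 1))) := by gcongr
      _ = _ := by ring

/-- Schedules can be pushed forward along a Lipschitz map of spaces and an injection of server
labels; servers outside the range stay put. -/
lemma opt_map_le {M N T T' : Type*} [MetricSpace M] [MetricSpace N] {K : ℝ≥0} (hK : K ≠ 0)
    {f : M → N} (hf : LipschitzWith K f) {e : T → T'} (he : Function.Injective e)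
    (b : T → M) (b' : T' → N) (σ : List M) :
    opt b' (σ.map f) ≤ confDist (b' ∘ e) (f ∘ b) + K * opt b σ := by
  refine le_add_mul_opt hK fun c hc => ?_
  let q : ℕ → T → N := fun j => if j = 0 then b' ∘ e else f ∘ c j
  have hq : travel σ.length q ≤ confDist (b' ∘ e) (f ∘ b) + K * travel σ.length c := by
    refine (travel_change_start_le _ _ (fun j => f ∘ c j)).trans ?_
    rw [hc.1]
    gcongr
    simp only [travel_eq_sum_confDist, Finset.mul_sum]
    exact Finset.sum_le_sum fun j _ => confDist_lipschitz_le hf _ _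
  refine le_trans ?_ hq
  have hs : Serves b' (σ.map f) (fun j => Function.extend e (q j) b') := by
    constructor
    · funext t
      by_cases ht : ∃ s, e s = t
      · obtain ⟨s, rfl⟩ := ht
        simp [he.extend_apply, q]
      · exact Function.extend_apply' _ _ _ ht
    · intro j hj
      obtain ⟨i, hi⟩ := hc.2 j (by simpa using hj)
      exact ⟨e i, by simp [he.extend_apply, q, hi]⟩
  refine (opt_le_travel hs).trans (le_of_eq ?_)
  simp only [travel_eq_sum_confDist, List.length_map, confDist_extend he]

/-! ### Lazy algorithms -/

/-- The configuration of the lazy algorithm that starts in `a` and, when the newest request of the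
history `τ` arrives, moves only the server with label `g τ`, to that request. -/
def lazyPos {M L : Type*} [DecidableEq L] (a : L → M) (g : List M → L) : List M → L → M
  | [] => a
  | x :: τ => Function.update (lazyPos a g τ) (g (x :: τ)) x

/-- The cost of the lazy algorithm given by `a` and `g`. -/
noncomputable def lazyCost {M L : Type*} [MetricSpace M] [DecidableEq L] (a : L → M)
    (g : List M → L) : List M → ℝ≥0∞
  | [] => 0
  | x :: τ => lazyCost a g τ + edist (lazyPos a g τ (g (x :: τ))) x

lemma isHistoryAlgorithm_lazyPos {M L : Type*} [DecidableEq L] (a : L → M) (g : List M → L) :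
    IsHistoryAlgorithm a (lazyPos a g) :=
  ⟨rfl, fun x τ => ⟨g (x :: τ), by simp [lazyPos]⟩⟩

lemma runCost_lazyPos {M L : Type*} [MetricSpace M] [DecidableEq L] (a : L → M) (g : List M → L)
    (τ : List M) : runCost (lazyPos a g) τ = lazyCost a g τ := by
  induction τ with
  | nil => rfl
  | cons x τ ih =>
    rw [runCost, lazyCost, ih, confDist, lazyPos]
    congr 1
    rw [tsum_eq_single (g (x :: τ))]
    · simp
    · intro i hi
      simp [Function.update_of_ne hi]

lemma lazyCost_ne_top {M L : Type*} [MetricSpace M] [DecidableEq L] (a : L → M) (g : List M → L)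
    (τ : List M) : lazyCost a g τ ≠ ⊤ := by
  induction τ with
  | nil => simp [lazyCost]
  | cons x τ ih => exact ENNReal.add_ne_top.2 ⟨ih, edist_ne_top _ _⟩

/-- Being lazy does not cost more: the distance between the lazy configuration and the
configuration of the simulated algorithm is saved so far. -/
lemma lazyCost_add_confDist_le {M L : Type*} [MetricSpace M] [DecidableEq L]
    (alg : List M → L → M) (g : List M → L) (hg : ∀ x τ, alg (x :: τ) (g (x :: τ)) = x)
    (τ : List M) :
    lazyCost (alg []) g τ + confDist (lazyPos (alg []) g τ) (alg τ) ≤ runCost alg τ := by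
  induction τ with
  | nil => simp [lazyCost, lazyPos, confDist_self, runCost]
  | cons x τ ih =>
    rw [runCost, lazyCost, lazyPos]
    refine le_trans ?_ (add_le_add_left ih _)
    rw [add_assoc, add_assoc]
    refine add_le_add le_rfl ?_
    set i₀ := g (x :: τ)
    set p := lazyPos (alg []) g τ
    have h : ∀ i, (if i = i₀ then edist (p i₀) x else 0) +
        edist (Function.update p i₀ x i) (alg (x :: τ) i) ≤
        edist (p i) (alg τ i) + edist (alg τ i) (alg (x :: τ) i) := by
      intro i
      by_cases hi : i = i₀
      · subst hi
        have := hg x τ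
        simp only [if_true, Function.update_self, i₀, this, edist_self, add_zero]
        exact edist_triangle _ _ _
      · simp only [hi, if_false, zero_add, Function.update_of_ne hi]
        exact edist_triangle _ _ _
    have := ENNReal.tsum_le_tsum h
    rw [ENNReal.tsum_add, ENNReal.tsum_add, tsum_ite_eq] at this
    exact this

lemma IsHistoryAlgorithm.exists_lazy {M L : Type*} [MetricSpace M] [DecidableEq L] {a : L → M}
    {alg : List M → L → M} (h : IsHistoryAlgorithm a alg) [Nonempty L] :
    ∃ g : List M → L, ∀ τ, lazyCost a g τ ≤ runCost alg τ := by
  choose i hi using h.serves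
  refine ⟨fun τ => match τ with
    | [] => Classical.arbitrary L
    | x :: τ => i x τ, fun τ => ?_⟩
  have := lazyCost_add_confDist_le alg (fun τ => match τ with
    | [] => Classical.arbitrary L
    | x :: τ => i x τ) hi τ
  rw [h.nil] at this
  exact le_self_add.trans this

/-! ### Numbering the servers by first use -/

/-- The labels used by the lazy algorithm `g`, in the order of first use. -/
def labels {M L : Type*} [DecidableEq L] (g : List M → L) : List M → List L
  | [] => []
  | x :: τ => if g (x :: τ) ∈ labels g τ then labels g τ else labels g τ ++ [g (x :: τ)]

/-- The lazy algorithm `g` with its labels numbered in the order of first use. -/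
def rank {M L : Type*} [DecidableEq L] (g : List M → L) (τ : List M) : ℕ :=
  (labels g τ).idxOf (g τ)

lemma labels_nodup {M L : Type*} [DecidableEq L] (g : List M → L) (τ : List M) :
    (labels g τ).Nodup := by
  induction τ with
  | nil => simp [labels]
  | cons x τ ih =>
    rw [labels]
    split_ifs with h
    · exact ih
    · exact List.nodup_append.2 ⟨ih, by simp, by
        intro a ha b hb hab
        rw [List.mem_singleton.1 hb] at hab
        exact h (hab ▸ ha)⟩

lemma length_labels_le {M L : Type*} [DecidableEq L] (g : List M → L) (τ : List M) :
    (labels g τ).length ≤ τ.length := by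
  induction τ with
  | nil => simp [labels]
  | cons x τ ih =>
    rw [labels]
    split_ifs with h
    · simp; lia
    · simpa using ih

lemma length_labels_le_cons {M L : Type*} [DecidableEq L] (g : List M → L) (x : M) (τ : List M) :
    (labels g τ).length ≤ (labels g (x :: τ)).length := by
  rw [labels]
  split_ifs with h <;> simp

lemma mem_labels_cons {M L : Type*} [DecidableEq L] (g : List M → L) (x : M) (τ : List M) (l : L) :
    l ∈ labels g (x :: τ) ↔ l = g (x :: τ) ∨ l ∈ labels g τ := by
  rw [labels]
  split_ifs with h
  · exact ⟨Or.inr, by rintro (rfl | h') <;> assumption⟩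
  · simp [or_comm]

lemma rank_lt {M L : Type*} [DecidableEq L] (g : List M → L) (x : M) (τ : List M) :
    rank g (x :: τ) < (labels g (x :: τ)).length :=
  List.idxOf_lt_length_of_mem ((mem_labels_cons g x τ _).2 (Or.inl rfl))

lemma rank_le_length {M L : Type*} [DecidableEq L] (g : List M → L) (τ : List M) :
    rank g τ ≤ τ.length :=
  List.idxOf_le_length.trans (length_labels_le g τ)

lemma lazyPos_of_notMem {M L : Type*} [DecidableEq L] (a : L → M) (g : List M → L) (τ : List M)
    {l : L} (hl : l ∉ labels g τ) : lazyPos a g τ l = a l := by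
  induction τ with
  | nil => rfl
  | cons x τ ih =>
    rw [mem_labels_cons, not_or] at hl
    rw [lazyPos, Function.update_of_ne hl.1, ih hl.2]

lemma lazyPos_rank_of_le {M L : Type*} [DecidableEq L] (a : ℕ → M) (g : List M → L) (τ : List M)
    {n : ℕ} (hn : (labels g τ).length ≤ n) : lazyPos a (rank g) τ n = a n := by
  induction τ with
  | nil => rfl
  | cons x τ ih =>
    have h := rank_lt g x τ
    rw [lazyPos, Function.update_of_ne (by lia), ih ((length_labels_le_cons g x τ).trans hn)]

lemma lazyPos_rank {M L : Type*} [DecidableEq L] (s : M) (g : List M → L) (τ : List M) {l : L}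
    (hl : l ∈ labels g τ) :
    lazyPos (fun _ => s) (rank g) τ ((labels g τ).idxOf l) = lazyPos (fun _ => s) g τ l := by
  induction τ with
  | nil => simp [labels] at hl
  | cons x τ ih =>
    rw [lazyPos, lazyPos]
    by_cases h : l = g (x :: τ)
    · subst h
      simp [rank]
    · have hl' : l ∈ labels g τ := by
        rw [mem_labels_cons] at hl
        tauto
      have hne : (labels g (x :: τ)).idxOf l ≠ rank g (x :: τ) := fun h' =>
        h ((List.idxOf_inj hl).1 h')
      rw [Function.update_of_ne h, Function.update_of_ne hne, ← ih hl']
      congr 1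
      rw [labels]
      split_ifs
      · rfl
      · exact List.idxOf_append_of_mem hl'

lemma lazyCost_rank {M L : Type*} [MetricSpace M] [DecidableEq L] (s : M) (g : List M → L)
    (τ : List M) : lazyCost (fun _ => s) (rank g) τ = lazyCost (fun _ => s) g τ := by
  induction τ with
  | nil => rfl
  | cons x τ ih =>
    rw [lazyCost, lazyCost, ih]
    congr 2
    by_cases h : g (x :: τ) ∈ labels g τ
    · rw [← lazyPos_rank s g τ h, rank]
      simp [labels, h]
    · rw [lazyPos_of_notMem _ _ _ h, lazyPos_rank_of_le]
      simp [rank, labels, h, List.idxOf_append_of_notMem h]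

/-- If all requests are at distance at least `R` from the source, every used server costs at least
`R`. -/
lemma mul_length_labels_le_lazyCost {M N L : Type*} [MetricSpace N] [DecidableEq L] (s : N)
    (g : List N → L) {R : ℝ≥0∞} (f : M → N) (hR : ∀ x, R ≤ edist s (f x)) (τ : List M) :
    R * (labels g (τ.map f)).length ≤ lazyCost (fun _ => s) g (τ.map f) := by
  induction τ with
  | nil => simp [labels]
  | cons x τ ih =>
    rw [List.map_cons, lazyCost, labels]
    split_ifs with h
    · exact ih.trans le_self_add
    · rw [List.length_append, List.length_singleton, Nat.cast_add, mul_add, Nat.cast_one, mul_one]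
      gcongr
      rw [lazyPos_of_notMem _ _ _ h]
      exact hR x

/-! ### Finitely many online servers: guessing the optimal cost -/

lemma confDist_lazyPos_cons {M L : Type*} [MetricSpace M] [DecidableEq L] (a : L → M)
    (g : List M → L) (x : M) (τ : List M) :
    confDist (lazyPos a g τ) (lazyPos a g (x :: τ)) = edist (lazyPos a g τ (g (x :: τ))) x := by
  have h := runCost_lazyPos a g (x :: τ)
  rw [runCost, lazyCost, runCost_lazyPos] at h
  exact (ENNReal.add_right_inj (lazyCost_ne_top a g τ)).1 h

lemma opt_fin_ne_top {M : Type*} [MetricSpace M] {h : ℕ} (hh : 1 ≤ h) (b : Fin h → M)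
    (σ : List M) : opt b σ ≠ ⊤ := by
  have := opt_le_runCost (isHistoryAlgorithm_lazyPos b (fun _ => (⟨0, hh⟩ : Fin h))) σ.reverse
  rw [runCost_lazyPos, List.reverse_reverse] at this
  exact ne_top_of_le_ne_top (lazyCost_ne_top _ _ _) this

/-- With finitely many servers, the initial configurations only affect the additive constant. -/
lemma IsCompetitive.change_start {M : Type*} [MetricSpace M] {h k : ℕ} {a₀ : Fin k → M}
    {b₀ : Fin h → M} {ρ : ℝ≥0} (H : IsCompetitive a₀ b₀ ρ) (a : Fin k → M) (b : Fin h → M) :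
    IsCompetitive a b ρ := by
  obtain ⟨alg, halg, c, hc⟩ := H.exists_history
  let alg' : List M → Fin k → M := fun τ => if τ = [] then a else alg τ
  have h' : IsHistoryAlgorithm a alg' := ⟨by simp [alg'], fun x τ => by
    simpa [alg'] using halg.serves x τ⟩
  have hcost : ∀ τ, runCost alg' τ ≤ confDist a a₀ + runCost alg τ := by
    intro τ
    induction τ with
    | nil => simp [runCost]
    | cons x τ ih =>
      rw [runCost, runCost]
      by_cases hτ : τ = []
      · subst hτ
        simpa [alg', runCost, halg.nil] using confDist_triangle a a₀ (alg [x])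
      · have e : alg' τ = alg τ := if_neg hτ
        have e' : alg' (x :: τ) = alg (x :: τ) := if_neg (by simp)
        rw [e, e', ← add_assoc]
        gcongr
  have hopt : ∀ σ, opt b₀ σ ≤ confDist b₀ b + opt b σ := by
    intro σ
    simpa using opt_map_le one_ne_zero LipschitzWith.id Function.injective_id b b₀ σ
  refine isCompetitive_of_history H.1 h'
    (c := (confDist a a₀).toNNReal + ρ * (confDist b₀ b).toNNReal + c) fun τ => ?_
  push_cast
  rw [ENNReal.coe_toNNReal (confDist_fin_ne_top _ _),
    ENNReal.coe_toNNReal (confDist_fin_ne_top _ _)]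
  calc runCost alg' τ ≤ confDist a a₀ + (ρ * opt b₀ τ.reverse + c) :=
        (hcost τ).trans (by gcongr; exact hc τ)
    _ ≤ confDist a a₀ + (ρ * (confDist b₀ b + opt b τ.reverse) + c) := by
        gcongr
        exact hopt _
    _ = _ := by ring

/-- Lazy algorithms starting at `o` with a guess `h * R` for the optimal cost of `h` servers: if the
guess is at least the optimal cost, the cost is `O(h * R)` and only `O(h)` servers are used.
Here `n τ` bounds the labels used on the history `τ`, and `1 ≤ R` allows an additive constant to be
absorbed into `h * R`. -/
def HasGuessingAlgorithms {M : Type*} [MetricSpace M] (o : M) (h : ℕ) (ρ : ℝ≥0) : Prop :=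
  ∀ R : ℝ≥0, 1 ≤ R → ∃ (g : List M → ℕ) (n : List M → ℕ),
    (∀ x τ, g (x :: τ) < n (x :: τ)) ∧ (∀ x τ, n τ ≤ n (x :: τ)) ∧
    ∀ τ, lazyCost (fun _ : ℕ => o) g τ + R * n τ ≤
      ρ * (opt (fun _ : Fin h => o) τ.reverse + h * R)

/-- Doubling: the online algorithm follows the guessing algorithm for the least `R = 2 ^ p` whose
budget is not exceeded, and moves all servers to the new configuration when `p` grows. -/
lemma HasGuessingAlgorithms.isCompetitive {M : Type*} [MetricSpace M] {o : M} {h : ℕ} {ρ : ℝ≥0}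
    (H : HasGuessingAlgorithms o h ρ) (hρ : 1 ≤ ρ) (hh : 1 ≤ h) {k : ℕ} (hk : 2 * ρ * h ≤ k) :
    IsCompetitive (fun _ : Fin k => o) (fun _ : Fin h => o) (12 * ρ) := by
  have H' : ∀ p : ℕ, ∃ (g : List M → ℕ) (n : List M → ℕ),
      (∀ x τ, g (x :: τ) < n (x :: τ)) ∧ (∀ x τ, n τ ≤ n (x :: τ)) ∧
      ∀ τ, lazyCost (fun _ : ℕ => o) g τ + 2 ^ p * n τ ≤
        ρ * (opt (fun _ : Fin h => o) τ.reverse + h * 2 ^ p) := by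
    intro p
    simpa using H (2 ^ p) (one_le_pow₀ one_le_two)
  choose g n hgn hnm hcost using H'
  have hρ0 : (ρ : ℝ≥0∞) ≠ 0 := by
    simpa using (zero_lt_one.trans_le hρ).ne'
  -- `p` is good on `τ` if the cost is within the bound for the optimal cost `h * 2 ^ p`.
  let Good : ℕ → List M → Prop := fun p τ =>
    lazyCost (fun _ : ℕ => o) (g p) τ + 2 ^ p * n p τ ≤ ρ * (h * 2 ^ p + h * 2 ^ p)
  have good_of_opt : ∀ p τ, opt (fun _ : Fin h => o) τ.reverse ≤ h * 2 ^ p → Good p τ :=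
    fun p τ hp => (hcost p τ).trans (by gcongr)
  have good_cons : ∀ p x τ, Good p (x :: τ) → Good p τ := by
    intro p x τ hp
    refine le_trans ?_ hp
    rw [lazyCost]
    gcongr
    · exact le_self_add
    · exact hnm p x τ
  have hex : ∀ τ, ∃ p, Good p τ := by
    intro τ
    obtain ⟨m, hm⟩ := ENNReal.exists_nat_gt (opt_fin_ne_top hh (fun _ : Fin h => o) τ.reverse)
    refine ⟨m, good_of_opt m τ (hm.le.trans ?_)⟩
    have h1 : m ≤ h * 2 ^ m := Nat.lt_two_pow_self.le.trans (Nat.le_mul_of_pos_left _ hh)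
    exact_mod_cast h1
  classical
  let P : List M → ℕ := fun τ => Nat.find (hex τ)
  have hP : ∀ τ, Good (P τ) τ := fun τ => Nat.find_spec (hex τ)
  have hPopt : ∀ τ, (h : ℝ≥0∞) * 2 ^ P τ ≤ 2 * opt (fun _ : Fin h => o) τ.reverse + h := by
    intro τ
    rcases hp : P τ with _ | q
    · simp
    · have : ¬ Good q τ := Nat.find_min (hex τ) (m := q) (by change q < P τ; lia)
      have h2 : (h : ℝ≥0∞) * 2 ^ q ≤ opt (fun _ : Fin h => o) τ.reverse := by
        by_contra h3
        exact this (good_of_opt q τ (not_le.1 h3).le)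
      calc (h : ℝ≥0∞) * 2 ^ (q + 1) = 2 * (h * 2 ^ q) := by ring
        _ ≤ 2 * opt (fun _ : Fin h => o) τ.reverse := by gcongr
        _ ≤ _ := le_self_add
  have hPm : ∀ x τ, P τ ≤ P (x :: τ) := fun x τ => Nat.find_min' _ (good_cons _ x τ (hP _))
  -- The budget bounds the number of labels used, so that `k` servers suffice.
  have hnk : ∀ τ, n (P τ) τ ≤ k := by
    intro τ
    have h1 : (2 : ℝ≥0∞) ^ P τ * n (P τ) τ ≤ 2 ^ P τ * (2 * ρ * h) :=
      (le_add_self.trans (hP τ)).trans (le_of_eq (by ring))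
    have h2 : (n (P τ) τ : ℝ≥0∞) ≤ 2 * ρ * h :=
      (ENNReal.mul_le_mul_iff_right (by simp) (by simp)).1 h1
    have h3 : (2 * ρ * h : ℝ≥0∞) ≤ k := by exact_mod_cast hk
    exact_mod_cast h2.trans h3
  let alg : List M → Fin k → M := fun τ => lazyPos (fun _ => o) (g (P τ)) τ ∘ Fin.val
  have halg : IsHistoryAlgorithm (fun _ : Fin k => o) alg := by
    refine ⟨rfl, fun x τ => ⟨⟨g (P (x :: τ)) (x :: τ), (hgn _ x τ).trans_le (hnk _)⟩, ?_⟩⟩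
    simp [alg, lazyPos]
  have hdist : ∀ τ, confDist (fun _ : Fin k => o) (alg τ) ≤
      lazyCost (fun _ => o) (g (P τ)) τ := by
    intro τ
    rw [← runCost_lazyPos]
    exact (confDist_comp_le (fun _ : ℕ => o) _ Fin.val_injective).trans
      (confDist_le_runCost (lazyPos (fun _ => o) (g (P τ))) τ)
  have hinv : ∀ τ, runCost alg τ ≤
      lazyCost (fun _ => o) (g (P τ)) τ + 4 * ρ * (h * 2 ^ P τ) := by
    intro τ
    induction τ with
    | nil => simp [runCost]
    | cons x τ ih =>
      rw [runCost]
      rcases (hPm x τ).eq_or_lt with hp | hp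
      · have h1 : confDist (alg τ) (alg (x :: τ)) ≤
            edist (lazyPos (fun _ => o) (g (P τ)) τ (g (P τ) (x :: τ))) x := by
          rw [← confDist_lazyPos_cons]
          simp only [alg, ← hp]
          exact confDist_comp_le _ _ Fin.val_injective
        rw [← hp, lazyCost]
        calc _ ≤ _ := add_le_add ih h1
          _ = _ := by ring
      · -- The guess grows: all servers move from the old configuration to the new one via `o`.
        have h1 := hdist τ
        have h2 := hdist (x :: τ)
        have h3 : lazyCost (fun _ => o) (g (P τ)) τ ≤ 2 * ρ * (h * 2 ^ P τ) :=
          (le_self_add.trans (hP τ)).trans (le_of_eq (by ring))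
        have h4 : (2 : ℝ≥0∞) ^ (P τ + 1) ≤ 2 ^ P (x :: τ) :=
          pow_le_pow_right₀ one_le_two hp
        have h5 := confDist_triangle (alg τ) (fun _ => o) (alg (x :: τ))
        rw [confDist_comm (alg τ) (fun _ => o)] at h5
        calc _ ≤ (2 * ρ * (h * 2 ^ P τ) + 4 * ρ * (h * 2 ^ P τ)) +
              (2 * ρ * (h * 2 ^ P τ) + lazyCost (fun _ => o) (g (P (x :: τ))) (x :: τ)) :=
              add_le_add (ih.trans (add_le_add h3 le_rfl))
                (h5.trans (add_le_add (h1.trans h3) h2))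
          _ = lazyCost (fun _ => o) (g (P (x :: τ))) (x :: τ) +
              4 * ρ * (h * 2 ^ (P τ + 1)) := by ring
          _ ≤ _ := by gcongr
  refine isCompetitive_of_history (hρ.trans (le_mul_of_one_le_left' (by norm_num))) halg
    (c := 6 * ρ * h) fun τ => ?_
  calc runCost alg τ ≤ 2 * ρ * (h * 2 ^ P τ) + 4 * ρ * (h * 2 ^ P τ) :=
        (hinv τ).trans (add_le_add ((le_self_add.trans (hP τ)).trans (le_of_eq (by ring))) le_rfl)
    _ = 6 * ρ * (h * 2 ^ P τ) := by ring
    _ ≤ 6 * ρ * (2 * opt (fun _ : Fin h => o) τ.reverse + h) := by gcongr; exact hPopt τ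
    _ = _ := by push_cast; ring

/-- Requests in `M` are sent by finitely many maps `f j` into infinite server problems whose source
is at distance about `R` from all requests. The guess `h * R` pays for moving `h` offline servers
away from the source, and using a server online costs at least `R`. -/
lemma hasGuessingAlgorithms_of_games {J M N : Type*} [Fintype J] [DecidableEq J] [MetricSpace M]
    [MetricSpace N] {o : M} {s : N} {K : ℝ≥0} {γ : List N → ℕ}
    (hγ : ∀ τ, lazyCost (fun _ : ℕ => s) γ τ ≤ K * opt (fun _ : ℕ => s) τ.reverse + K)
    (H : ∀ R : ℝ≥0, 1 ≤ R → ∃ (f : J → M → N) (g : J → N → M),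
      (∀ j, LipschitzWith 1 (f j)) ∧ (∀ j, LipschitzWith 1 (g j)) ∧ (∀ j, g j s = o) ∧
      (∀ j, edist s (f j o) ≤ R) ∧ (∀ j x, R ≤ edist s (f j x)) ∧ ∀ x, ∃ j, g j (f j x) = x)
    {h : ℕ} (hh : 1 ≤ h) : HasGuessingAlgorithms o h (Fintype.card J * 4 * K) := by
  intro R hR
  obtain ⟨f, g, hf, hg, hgs, hfo, hfR, hcov⟩ := H R hR
  choose j hj using hcov
  -- All games are played on all requests, and the servers of all games are projected to `M`.
  let conf : List M → J × ℕ → M := fun τ i => g i.1 (lazyPos (fun _ => s) γ (τ.map (f i.1)) i.2)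
  let G : List M → J × ℕ := fun τ => match τ with
    | [] => (j o, 0)
    | x :: τ => (j x, γ ((x :: τ).map (f (j x))))
  have hG : ∀ x τ, conf (x :: τ) (G (x :: τ)) = x := fun x τ => by
    simp [conf, G, lazyPos, hj]
  have hnil : conf [] = fun _ => o := by
    funext i
    simp [conf, lazyPos, hgs]
  have hrun : ∀ τ, runCost conf τ ≤ ∑ i, lazyCost (fun _ => s) γ (τ.map (f i)) := by
    intro τ
    induction τ with
    | nil => simp [runCost]
    | cons x τ ih =>
      rw [runCost]
      simp only [List.map_cons, lazyCost, Finset.sum_add_distrib]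
      refine add_le_add ih ?_
      rw [confDist,
        ENNReal.tsum_prod (f := fun i l => edist (conf τ (i, l)) (conf (x :: τ) (i, l))),
        tsum_fintype]
      refine Finset.sum_le_sum fun i _ => ?_
      rw [← confDist_lazyPos_cons]
      refine (confDist_lipschitz_le (hg i) (lazyPos (fun _ => s) γ (τ.map (f i)))
        (lazyPos (fun _ => s) γ (f i x :: τ.map (f i)))).trans ?_
      rw [ENNReal.coe_one, one_mul]
  have hlazy : ∀ τ, lazyCost (fun _ => o) G τ ≤ ∑ i, lazyCost (fun _ => s) γ (τ.map (f i)) := by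
    intro τ
    have := lazyCost_add_confDist_le conf G hG τ
    rw [hnil] at this
    exact (le_self_add.trans this).trans (hrun τ)
  have hmem : ∀ τ l, l ∈ labels G τ → l.2 ∈ labels γ (τ.map (f l.1)) := by
    intro τ
    induction τ with
    | nil => simp [labels]
    | cons x τ ih =>
      intro l hl
      rw [List.map_cons, mem_labels_cons]
      rcases (mem_labels_cons G x τ l).1 hl with rfl | hl
      · left
        simp [G]
      · exact Or.inr (ih l hl)
  have hlen : ∀ τ, (labels G τ).length ≤ ∑ i, (labels γ (τ.map (f i))).length := by
    intro τ
    rw [← List.toFinset_card_of_nodup (labels_nodup G τ)]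
    have hsub : (labels G τ).toFinset ⊆ Finset.univ.biUnion fun i =>
        (labels γ (τ.map (f i))).toFinset.image (Prod.mk i) := by
      intro l hl
      have := hmem τ l (List.mem_toFinset.1 hl)
      simp only [Finset.mem_biUnion, Finset.mem_univ, true_and, Finset.mem_image,
        List.mem_toFinset]
      exact ⟨l.1, l.2, this, rfl⟩
    refine (Finset.card_le_card hsub).trans (Finset.card_biUnion_le.trans ?_)
    exact Finset.sum_le_sum fun i _ => Finset.card_image_le.trans (List.toFinset_card_le _)
  have hlenR : ∀ τ, (R : ℝ≥0∞) * (labels G τ).length ≤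
      ∑ i, lazyCost (fun _ => s) γ (τ.map (f i)) := by
    intro τ
    calc (R : ℝ≥0∞) * (labels G τ).length
        ≤ R * ((∑ i, (labels γ (τ.map (f i))).length : ℕ) : ℝ≥0∞) := by
          gcongr
          exact hlen τ
      _ = ∑ i, R * ((labels γ (τ.map (f i))).length : ℝ≥0∞) := by
          push_cast
          rw [Finset.mul_sum]
      _ ≤ _ := Finset.sum_le_sum fun i _ => mul_length_labels_le_lazyCost s γ (f i) (hfR i) τ
  have hgame : ∀ (τ : List M) (i : J), lazyCost (fun _ => s) γ (τ.map (f i)) ≤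
      2 * K * (opt (fun _ : Fin h => o) τ.reverse + h * R) := by
    intro τ i
    have h1 := opt_map_le one_ne_zero (hf i) (Fin.val_injective (n := h)) (fun _ => o)
      (fun _ => s) τ.reverse
    have h2 : confDist ((fun _ : ℕ => s) ∘ Fin.val) (f i ∘ fun _ : Fin h => o) ≤ h * R := by
      rw [confDist, tsum_fintype]
      simpa using mul_le_mul_right (hfo i) (h : ℝ≥0∞)
    have h3 : (1 : ℝ≥0∞) ≤ h * R := by
      have : (1 : ℝ≥0) ≤ h * R := one_le_mul (by exact_mod_cast hh) hR
      exact_mod_cast this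
    calc _ ≤ K * opt (fun _ : ℕ => s) (τ.map (f i)).reverse + K := hγ _
      _ ≤ K * (h * R + opt (fun _ : Fin h => o) τ.reverse) + K * (h * R) := by
          rw [← List.map_reverse]
          refine add_le_add ?_ (le_mul_of_one_le_right' h3)
          gcongr
          simpa using h1.trans (add_le_add h2 le_rfl)
      _ ≤ K * (h * R + opt (fun _ : Fin h => o) τ.reverse) +
          K * (h * R + opt (fun _ : Fin h => o) τ.reverse) := by
          gcongr
          exact le_self_add
      _ = _ := by ring
  refine ⟨rank G, fun τ => (labels G τ).length, rank_lt G, length_labels_le_cons G, fun τ => ?_⟩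
  rw [lazyCost_rank]
  calc _ ≤ _ := add_le_add (hlazy τ) (hlenR τ)
    _ ≤ ∑ _i : J, 2 * K * (opt (fun _ : Fin h => o) τ.reverse + h * R) +
        ∑ _i : J, 2 * K * (opt (fun _ : Fin h => o) τ.reverse + h * R) := by
        gcongr <;> exact hgame τ _
    _ = _ := by
        simp only [Finset.sum_const, Finset.card_univ, nsmul_eq_mul]
        push_cast
        ring

/-- In `M × ℝ` with the maximum metric, `(o, 0)` is a source at distance `max (dist o x) R` from the
copy `(x, R)` of the point `x`. -/
lemma hasGuessingAlgorithms_of_prod {M : Type*} [MetricSpace M] {o : M} {K : ℝ≥0}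
    {γ : List (M × ℝ) → ℕ}
    (hγ : ∀ τ, lazyCost (fun _ : ℕ => (o, (0 : ℝ))) γ τ ≤
      K * opt (fun _ : ℕ => (o, (0 : ℝ))) τ.reverse + K) {h : ℕ} (hh : 1 ≤ h) :
    HasGuessingAlgorithms o h (4 * K) := by
  suffices H : HasGuessingAlgorithms o h (Fintype.card Unit * 4 * K) by simpa using H
  refine hasGuessingAlgorithms_of_games hγ (fun R hR => ?_) hh
  have hR' : edist (0 : ℝ) (R : ℝ) = R := by
    rw [edist_comm, edist_eq_enorm_sub, sub_zero]
    simp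
  refine ⟨fun _ x => (x, R), fun _ => Prod.fst, fun _ => ?_, fun _ => LipschitzWith.prod_fst,
    fun _ => rfl, fun _ => ?_, fun _ x => ?_, fun x => ⟨(), rfl⟩⟩
  · exact LipschitzWith.of_edist_le fun x y => by simp [Prod.edist_eq]
  · rw [Prod.edist_eq]
    simp [hR']
  · rw [Prod.edist_eq]
    simp [hR']

/-- On the line, the two half-lines that start at `o` are moved to distance `R` from the source `0`
and treated as two separate problems. -/
lemma hasGuessingAlgorithms_real {K : ℝ≥0} {γ : List ℝ → ℕ}
    (hγ : ∀ τ, lazyCost (fun _ : ℕ => (0 : ℝ)) γ τ ≤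
      K * opt (fun _ : ℕ => (0 : ℝ)) τ.reverse + K) (o : ℝ) {h : ℕ} (hh : 1 ≤ h) :
    HasGuessingAlgorithms o h (8 * K) := by
  have e : ((Fintype.card Bool : ℕ) : ℝ≥0) * 4 * K = 8 * K := by norm_num
  rw [← e]
  refine hasGuessingAlgorithms_of_games hγ (fun R hR => ?_) hh
  let ε : Bool → ℝ := fun j => if j then 1 else -1
  have hε : ∀ j, ε j = 1 ∨ ε j = -1 := by
    rintro (_ | _) <;> simp [ε]
  have hR0 : (0 : ℝ) ≤ R := R.2
  have hmax : ∀ a b : ℝ, |max a 0 - max b 0| ≤ |a - b| := fun a b =>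
    abs_max_sub_max_le_abs a b 0
  refine ⟨fun j x => R + max (ε j * (x - o)) 0, fun j y => o + ε j * max (y - R) 0,
    fun j => ?_, fun j => ?_, fun j => ?_, fun j => ?_, fun j x => ?_, fun x => ?_⟩
  · refine LipschitzWith.of_dist_le_mul fun x y => ?_
    have := hmax (ε j * (x - o)) (ε j * (y - o))
    rw [← mul_sub, abs_mul] at this
    rw [Real.dist_eq, Real.dist_eq]
    rcases hε j with e | e <;> simp [e] at this ⊢ <;> exact this
  · refine LipschitzWith.of_dist_le_mul fun x y => ?_
    have := hmax (x - R) (y - R)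
    rw [Real.dist_eq, Real.dist_eq, add_sub_add_left_eq_sub, ← mul_sub, abs_mul]
    rcases hε j with e | e <;> simpa [e] using this
  · simp [hR0]
  · simp
  · rw [edist_dist, dist_comm, Real.dist_eq, sub_zero, ENNReal.le_ofReal_iff_toReal_le (by simp)
      (abs_nonneg _)]
    refine le_trans ?_ (le_abs_self _)
    simp
  · rcases le_total o x with hx | hx
    · exact ⟨true, by simp [ε, hx]⟩
    · exact ⟨false, by simp [ε, hx]⟩

/-! ### Removing the additive constant -/

lemma confDist_le_travel {M S : Type*} [MetricSpace M] (n : ℕ) (c : ℕ → S → M) :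
    confDist (c 0) (c n) ≤ travel n c := by
  rw [travel_eq_sum_confDist]
  induction n with
  | zero => simp [confDist_self]
  | succ n ih =>
    rw [Finset.sum_range_succ]
    exact (confDist_triangle _ (c n) _).trans (by gcongr)

/-- The optimal offline cost of serving `σ` with servers `T` that start at `s` and return to `s`. -/
noncomputable def closedOpt {M : Type*} [MetricSpace M] (T : Type*) (s : M) (σ : List M) : ℝ≥0∞ :=
  ⨅ (c : ℕ → T → M) (_ : Serves (fun _ => s) σ c),
    travel σ.length c + confDist (c σ.length) (fun _ => s)

lemma opt_le_closedOpt {M : Type*} [MetricSpace M] (T : Type*) (s : M) (σ : List M) :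
    opt (fun _ : T => s) σ ≤ closedOpt T s σ :=
  iInf₂_mono fun _ _ => le_self_add

lemma closedOpt_nil {M : Type*} [MetricSpace M] (T : Type*) (s : M) :
    closedOpt T s ([] : List M) = 0 := by
  have hs : Serves (fun _ : T => s) ([] : List M) (fun _ _ => s) :=
    ⟨rfl, fun j hj => absurd hj (Nat.not_lt_zero j)⟩
  exact le_antisymm ((iInf₂_le _ hs).trans (by simp [travel, confDist_self])) zero_le

/-- After returning to `s`, the offline servers can serve `σ` from there and return once more. The
way back is no longer than the way out. -/
lemma closedOpt_append_le {M : Type*} [MetricSpace M] (T : Type*) (s : M) (σ₀ σ : List M) :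
    closedOpt T s (σ₀ ++ σ) ≤ closedOpt T s σ₀ + 2 * opt (fun _ : T => s) σ := by
  refine le_add_mul_opt (K := 2) two_ne_zero fun c hc => ?_
  rw [closedOpt, closedOpt, ENNReal.iInf_add]
  refine le_iInf fun c₀ => ?_
  rw [ENNReal.iInf_add]
  refine le_iInf fun hc₀ => ?_
  rcases σ.eq_nil_or_concat with rfl | ⟨σ', y, hσ⟩
  · rw [List.append_nil]
    exact (iInf₂_le c₀ hc₀).trans le_self_add
  have hpos : σ.length ≠ 0 := by simp [hσ]
  -- The server labelled `t` goes from its last position in `c₀` to its first position in `c`; the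
  -- detour through `s` bounds the distance.
  let C : ℕ → T → M := fun j => if j ≤ σ₀.length then c₀ j else c (j - σ₀.length)
  have hC : ∀ j, C (σ₀.length + j) = if j = 0 then c₀ σ₀.length else c j := by
    intro j
    rcases Nat.eq_zero_or_pos j with rfl | hj
    · simp [C]
    · simp only [C, if_neg hj.ne']
      rw [if_neg (by lia), Nat.add_sub_cancel_left]
  have hserves : Serves (fun _ => s) (σ₀ ++ σ) C := by
    refine ⟨by simp [C, hc₀.1], fun j hj => ?_⟩
    rcases lt_or_ge j σ₀.length with h | h
    · obtain ⟨i, hi⟩ := hc₀.2 j h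
      refine ⟨i, ?_⟩
      simp only [C]
      rw [if_pos (Nat.succ_le_of_lt h), hi, List.getElem_append_left h]
    · obtain ⟨m, rfl⟩ := Nat.exists_eq_add_of_le h
      rw [List.length_append] at hj
      obtain ⟨i, hi⟩ := hc.2 m (by lia)
      refine ⟨i, ?_⟩
      rw [add_assoc, hC, if_neg (by lia), hi, List.getElem_append_right h]
      simp
  refine (iInf₂_le C hserves).trans ?_
  have h1 : travel (σ₀ ++ σ).length C ≤ travel σ₀.length c₀ +
      (confDist (c₀ σ₀.length) (fun _ => s) + travel σ.length c) := by
    rw [travel_eq_sum_confDist, travel_eq_sum_confDist, List.length_append, Finset.sum_range_add]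
    refine add_le_add (le_of_eq (Finset.sum_congr rfl fun j hj => ?_)) ?_
    · have hj := Finset.mem_range.1 hj
      simp only [C, if_pos hj.le, if_pos (Nat.succ_le_of_lt hj)]
    · have := travel_change_start_le (c₀ σ₀.length) σ.length c
      rw [hc.1, travel_eq_sum_confDist] at this
      simpa only [add_assoc, hC] using this
  have h2 : confDist (C (σ₀ ++ σ).length) (fun _ => s) ≤ travel σ.length c := by
    rw [List.length_append, hC, if_neg hpos, confDist_comm, ← hc.1]
    exact confDist_le_travel _ _
  calc _ ≤ travel σ₀.length c₀ + (confDist (c₀ σ₀.length) (fun _ => s) + travel σ.length c) +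
        travel σ.length c := add_le_add h1 h2
    _ = _ := by push_cast; ring

/-- A competitive algorithm is competitive with an arbitrarily small additive constant after a
suitable history `τ₀`, namely one that nearly maximizes the online cost minus `ρ` times the closed
offline cost. -/
lemma exists_history_runCost_le {M S : Type*} [MetricSpace M] {h : ℕ} (hh : 1 ≤ h) (s : M)
    (alg : List M → S → M) {ρ c : ℝ≥0}
    (H : ∀ τ, runCost alg τ ≤ ρ * opt (fun _ : Fin h => s) τ.reverse + c) {ε : ℝ≥0} (hε : 0 < ε) :
    ∃ τ₀, ∀ τ, runCost (fun τ' => alg (τ' ++ τ₀)) τ ≤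
      2 * ρ * opt (fun _ : Fin h => s) τ.reverse + ε := by
  have hopt : ∀ σ, opt (fun _ : Fin h => s) σ ≠ ⊤ := opt_fin_ne_top hh _
  have hclosed : ∀ σ, closedOpt (Fin h) s σ ≠ ⊤ := by
    intro σ
    have := closedOpt_append_le (Fin h) s [] σ
    rw [closedOpt_nil, zero_add] at this
    exact ne_top_of_le_ne_top (ENNReal.mul_ne_top (by simp) (hopt σ)) this
  have hrun : ∀ τ, runCost alg τ ≠ ⊤ := fun τ =>
    ne_top_of_le_ne_top (by finiteness [hopt τ.reverse]) (H τ)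
  let Φ : List M → ℝ := fun τ =>
    (runCost alg τ).toReal - ρ * (closedOpt (Fin h) s τ.reverse).toReal
  have hΦ : BddAbove (Set.range Φ) := by
    refine ⟨c, ?_⟩
    rintro _ ⟨τ, rfl⟩
    have h1 : runCost alg τ ≤ ρ * closedOpt (Fin h) s τ.reverse + c :=
      (H τ).trans (by gcongr; exact opt_le_closedOpt _ _ _)
    simp only [Φ]
    lift runCost alg τ to ℝ≥0 using hrun τ with A
    lift closedOpt (Fin h) s τ.reverse to ℝ≥0 using hclosed _ with W
    have h2 : A ≤ ρ * W + c := by exact_mod_cast h1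
    have h3 : (A : ℝ) ≤ ρ * W + c := by exact_mod_cast h2
    simp only [ENNReal.coe_toReal]
    linarith
  obtain ⟨_, ⟨τ₀, rfl⟩, hτ₀⟩ := exists_lt_of_lt_csSup (Set.range_nonempty Φ)
    (sub_lt_self (sSup (Set.range Φ)) (NNReal.coe_pos.2 hε))
  refine ⟨τ₀, fun τ => ?_⟩
  have h1 : Φ (τ ++ τ₀) ≤ Φ τ₀ + ε := by
    have := le_csSup hΦ ⟨τ ++ τ₀, rfl⟩
    linarith
  have h2 := closedOpt_append_le (Fin h) s τ₀.reverse τ.reverse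
  have h3 := runCost_append alg τ₀ τ
  have h4 := hrun (τ ++ τ₀)
  simp only [Φ, List.reverse_append] at h1
  rw [h3] at h1 h4
  have h5 := hrun τ₀
  have h6 := ne_top_of_le_ne_top h4 le_add_self
  generalize runCost (fun τ' => alg (τ' ++ τ₀)) τ = X at *
  lift X to ℝ≥0 using h6
  lift runCost alg τ₀ to ℝ≥0 using h5 with A
  lift closedOpt (Fin h) s (τ₀.reverse ++ τ.reverse) to ℝ≥0 using hclosed _ with W
  lift closedOpt (Fin h) s τ₀.reverse to ℝ≥0 using hclosed _ with W₀
  lift opt (fun _ : Fin h => s) τ.reverse to ℝ≥0 using hopt _ with O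
  have h7 : W ≤ W₀ + 2 * O := by exact_mod_cast h2
  have h8 : (W : ℝ) ≤ W₀ + 2 * O := by exact_mod_cast h7
  rw [← ENNReal.coe_add] at h1
  simp only [ENNReal.coe_toReal, NNReal.coe_add] at h1
  have h9 : (X : ℝ) ≤ 2 * ρ * O + ε := by
    have := mul_le_mul_of_nonneg_left h8 ρ.2
    change (ρ : ℝ) * W ≤ ρ * (W₀ + 2 * O) at this
    linarith
  have h10 : X ≤ 2 * ρ * O + ε := by exact_mod_cast h9
  exact_mod_cast h10

/-! ### Copying the infinite server problem into another space -/

/-- If `φ` scales by the factor `r` and moves no request much closer to the servers in `a` than to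
`φ s`, then a lazy algorithm on `N` starting in `a` can be simulated on `M` starting at `s`. -/
lemma mul_lazyCost_comp_map_le {M N L : Type*} [MetricSpace M] [MetricSpace N] [DecidableEq L]
    (a : L → N) (s : M) (g : List N → L) (φ : M → N) {r η : ℝ≥0} {F : Set M}
    (hφ : ∀ x y, edist (φ x) (φ y) = r * edist x y)
    (ha : ∀ l, ∀ x ∈ F, r * edist s x ≤ edist (a l) (φ x) + r * η)
    {τ : List M} (hτ : ∀ x ∈ τ, x ∈ F) :
    r * lazyCost (fun _ => s) (fun τ => g (τ.map φ)) τ ≤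
      lazyCost a g (τ.map φ) + τ.length * (r * η) := by
  have hpos : ∀ (τ : List M) (l : L),
      lazyPos a g (τ.map φ) l = φ (lazyPos (fun _ => s) (fun τ => g (τ.map φ)) τ l) ∨
      lazyPos (fun _ => s) (fun τ => g (τ.map φ)) τ l = s ∧ lazyPos a g (τ.map φ) l = a l := by
    intro τ
    induction τ with
    | nil => exact fun l => Or.inr ⟨rfl, rfl⟩
    | cons x τ ih =>
      intro l
      rw [List.map_cons, lazyPos, lazyPos, List.map_cons]
      by_cases hl : l = g (φ x :: τ.map φ)
      · subst hl
        simp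
      · rw [Function.update_of_ne hl, Function.update_of_ne hl]
        exact ih l
  induction τ with
  | nil => simp [lazyCost]
  | cons x τ ih =>
    have ih := ih fun y hy => hτ y (List.mem_cons_of_mem _ hy)
    rw [lazyCost, List.map_cons, lazyCost, mul_add]
    have h1 : r * edist (lazyPos (fun _ => s) (fun τ => g (τ.map φ)) τ (g (φ x :: τ.map φ))) x ≤
        edist (lazyPos a g (τ.map φ) (g (φ x :: τ.map φ))) (φ x) + r * η := by
      rcases hpos τ (g (φ x :: τ.map φ)) with h | ⟨h, h'⟩
      · rw [h, hφ]
        exact le_self_add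
      · rw [h, h']
        exact ha _ x (hτ x List.mem_cons_self)
    calc _ ≤ _ := add_le_add ih h1
      _ = _ := by
        rw [List.length_cons]
        push_cast
        ring

/-- Infinite server algorithms that are good for more and more requests have a limit. As the labels
used by them on a given history are bounded, an ultrafilter selects one. -/
lemma exists_lazy_limit {M ι : Type*} [MetricSpace M] (s : M) (f : Filter ι) [NeBot f]
    (g : ι → List M → ℕ) (hg : ∀ i τ, g i τ ≤ τ.length) {K C : ℝ≥0} (hK : K ≠ 0)
    (H : ∀ σ c, Serves (fun _ : ℕ => s) σ c →
      ∀ᶠ i in f, lazyCost (fun _ : ℕ => s) (g i) σ.reverse ≤ C + K * travel σ.length c) :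
    ∃ G : List M → ℕ, ∀ τ, lazyCost (fun _ : ℕ => s) G τ ≤
      C + K * opt (fun _ : ℕ => s) τ.reverse := by
  have hex : ∀ τ, ∃ n, ∀ᶠ i in (Ultrafilter.of f : Filter ι), g i τ = n := by
    intro τ
    have h1 : ∀ᶠ i in (Ultrafilter.of f : Filter ι), ∃ n ∈ Set.Iic τ.length, g i τ = n :=
      Eventually.of_forall fun i => ⟨_, hg i τ, rfl⟩
    obtain ⟨n, -, hn⟩ := (Ultrafilter.eventually_exists_mem_iff (Set.finite_Iic _)).1 h1
    exact ⟨n, hn⟩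
  choose G hG using hex
  have hlim : ∀ τ, ∀ᶠ i in (Ultrafilter.of f : Filter ι),
      lazyPos (fun _ : ℕ => s) (g i) τ = lazyPos (fun _ => s) G τ ∧
      lazyCost (fun _ : ℕ => s) (g i) τ = lazyCost (fun _ => s) G τ := by
    intro τ
    induction τ with
    | nil => exact Eventually.of_forall fun i => ⟨rfl, rfl⟩
    | cons x τ ih =>
      filter_upwards [ih, hG (x :: τ)] with i hi hi'
      simp only [lazyPos, lazyCost, hi.1, hi.2, hi', and_self]
  refine ⟨G, fun τ => le_add_mul_opt hK fun c hc => ?_⟩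
  obtain ⟨i, hi, hi'⟩ := ((hlim τ).and (Ultrafilter.of_le f (H _ c hc))).exists
  rw [← hi.2]
  simpa using hi'

/-- A schedule for infinitely many servers only needs finitely many of them. -/
lemma exists_opt_fin_le {M : Type*} [MetricSpace M] (s : M) {σ : List M} {c : ℕ → ℕ → M}
    (hc : Serves (fun _ => s) σ c) :
    ∃ n, ∀ h, n ≤ h → opt (fun _ : Fin h => s) σ ≤ travel σ.length c := by
  choose i hi using hc.2
  refine ⟨(Finset.univ.sup fun j : Fin σ.length => i j j.2) + 1, fun h hh => ?_⟩
  have hlt : ∀ j (hj : j < σ.length), i j hj < h := fun j hj =>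
    (Nat.lt_succ_of_le (Finset.le_sup (f := fun j : Fin σ.length => i j j.2)
      (Finset.mem_univ ⟨j, hj⟩))).trans_le hh
  refine (opt_le_travel (c := fun j => c j ∘ Fin.val) ⟨?_, fun j hj => ?_⟩).trans ?_
  · exact congrArg (· ∘ Fin.val) hc.1
  · exact ⟨⟨i j hj, hlt j hj⟩, hi j hj⟩
  · simp only [travel_eq_sum_confDist]
    exact Finset.sum_le_sum fun j _ => confDist_comp_le _ _ Fin.val_injective

/-- `N` contains scaled copies of `(M, s)` with common base point `s'`, with the property that for
given `k`, finite set `F` of requests and `η > 0`, wherever `k` servers are in `N`, the requests `F`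
in some copy are, up to the error `η`, no closer to any of these servers than to the base point.
The scaling factors may be taken bounded below. -/
def HasVacantCopies {M N : Type*} [MetricSpace M] [MetricSpace N] (s : M) (s' : N) : Prop :=
  ∀ (k : ℕ) (F : Finset M) (η : ℝ≥0), 0 < η → ∃ δ : ℝ≥0, 0 < δ ∧ ∀ a : Fin k → N,
    ∃ (φ : M → N) (r : ℝ≥0), δ ≤ r ∧ φ s = s' ∧ (∀ x y, edist (φ x) (φ y) = r * edist x y) ∧
      ∀ i, ∀ x ∈ F, r * edist s x ≤ edist (a i) (φ x) + r * η

/-- After a history that makes the additive constant negligible, the algorithm with `k` servers is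
run on requests in a vacant copy of `(M, s)` and simulated with servers that start at `s`. -/
lemma HasVacantCopies.exists_lazy {M N : Type*} [MetricSpace M] [MetricSpace N] {s : M} {s' : N}
    (H : HasVacantCopies s s') {h k : ℕ} (hh : 1 ≤ h) {ρ : ℝ≥0}
    (hk : HKServerCompetitive N h k ρ) (F : Finset M) :
    ∃ g : List M → ℕ, (∀ τ, g τ ≤ τ.length) ∧
      ∀ τ, (∀ x ∈ τ, x ∈ F) → τ.length ≤ h →
        lazyCost (fun _ : ℕ => s) g τ ≤ 2 + 2 * ρ * opt (fun _ : Fin h => s) τ.reverse := by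
  obtain ⟨alg, halg, c, hc⟩ := (hk (fun _ => s') (fun _ => s')).exists_history
  have : Nonempty (Fin k) := ⟨(halg.serves s' []).choose⟩
  have hh0 : (h : ℝ≥0) ≠ 0 := by
    have : h ≠ 0 := by lia
    exact_mod_cast this
  obtain ⟨δ, hδ, hcopy⟩ := H k F (h : ℝ≥0)⁻¹ (by positivity)
  obtain ⟨τ₀, hτ₀⟩ := exists_history_runCost_le hh s' alg hc hδ
  obtain ⟨φ, r, hr, hφs, hφ, ha⟩ := hcopy (alg τ₀)
  have halg' : IsHistoryAlgorithm (alg τ₀) fun τ => alg (τ ++ τ₀) :=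
    ⟨rfl, fun x τ => halg.serves x _⟩
  obtain ⟨g, hg⟩ := halg'.exists_lazy
  have hr0 : r ≠ 0 := (hδ.trans_le hr).ne'
  refine ⟨rank fun τ => g (τ.map φ), rank_le_length _, fun τ hτ hlen => ?_⟩
  rw [lazyCost_rank]
  have h1 := mul_lazyCost_comp_map_le (alg τ₀) s g φ (F := F) hφ ha hτ
  have hLip : LipschitzWith r φ := fun x y => (hφ x y).le
  have h2 := opt_map_le hr0 hLip Function.injective_id (fun _ : Fin h => s) (fun _ => s') τ.reverse
  have h3 : confDist ((fun _ : Fin h => s') ∘ id) (φ ∘ fun _ => s) = 0 := by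
    have : (φ ∘ fun _ : Fin h => s) = fun _ => s' := funext fun _ => hφs
    rw [this]
    exact confDist_self _
  rw [h3, zero_add, List.map_reverse] at h2
  have h4 : (τ.length : ℝ≥0∞) * (r * ((h : ℝ≥0)⁻¹ : ℝ≥0)) ≤ r := by
    have : (τ.length : ℝ≥0) * (r * (h : ℝ≥0)⁻¹) ≤ h * (r * (h : ℝ≥0)⁻¹) := by gcongr
    rw [mul_left_comm (h : ℝ≥0), mul_inv_cancel₀ hh0, mul_one] at this
    exact_mod_cast this
  have h5 : (r : ℝ≥0∞) * lazyCost (fun _ => s) (fun τ => g (τ.map φ)) τ ≤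
      r * (2 + 2 * ρ * opt (fun _ : Fin h => s) τ.reverse) :=
    calc _ ≤ _ := h1
      _ ≤ (2 * ρ * (r * opt (fun _ : Fin h => s) τ.reverse) + r) + r := by
        refine add_le_add ((hg _).trans ((hτ₀ _).trans ?_)) h4
        gcongr
      _ = _ := by ring
  exact (ENNReal.mul_le_mul_iff_right (by simpa using hr0) (by simp)).1 h5

/-- `(h, k)`-server algorithms with bounded ratio on `N` yield an infinite server algorithm on
`(M, s)`, whatever the numbers `k h` are. -/
lemma HasVacantCopies.infiniteServerCompetitive {M N : Type*} [MetricSpace M] [MetricSpace N]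
    {s : M} {s' : N} (H : HasVacantCopies s s') {ρ : ℝ≥0} {k : ℕ → ℕ}
    (hk : ∀ h, 1 ≤ h → HKServerCompetitive N h (k h) ρ) : InfiniteServerCompetitive M s := by
  classical
  have hρ : 1 ≤ ρ := (hk 1 le_rfl (fun _ => s') (fun _ => s')).1
  choose g hg hcost using fun i : ℕ × Finset M =>
    H.exists_lazy (Nat.le_add_left 1 i.1) (hk (i.1 + 1) (Nat.le_add_left 1 i.1)) i.2
  obtain ⟨G, hG⟩ := exists_lazy_limit s atTop g hg (K := 2 * ρ) (C := 2)
    (by simpa using (zero_lt_one.trans_le hρ).ne') (fun σ c hc => by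
      obtain ⟨n, hn⟩ := exists_opt_fin_le s hc
      -- Enough servers, a bound on the length, and all requests of `σ` among the admitted ones.
      filter_upwards [eventually_ge_atTop (max n σ.length, σ.toFinset)] with i hi
      obtain ⟨hi₁, hi₂⟩ := Prod.mk_le_mk.1 hi
      have h1 := le_of_max_le_left hi₁
      have h2 := le_of_max_le_right hi₁
      refine (hcost i σ.reverse (fun x hx => hi₂ (by simpa using hx)) (by simp; lia)).trans ?_
      rw [List.reverse_reverse]
      push_cast
      gcongr
      exact hn _ (by lia))
  refine ⟨2 * ρ, isCompetitive_of_history (hρ.trans (le_mul_of_one_le_left' one_le_two))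
    (isHistoryAlgorithm_lazyPos _ G) (c := 2) fun τ => ?_⟩
  rw [runCost_lazyPos, add_comm]
  exact hG τ

/-! ### Wedges of pointed metric spaces -/

/-- The disjoint union of the pointed spaces `(E i, s i)`, carrying the pseudometric for which all
base points have distance `0`. -/
def PreWedge {ι : Type} (E : ι → Type u) (_s : ∀ i, E i) : Type u := Σ i, E i

open Classical in
/-- The distance between two points in different spaces is measured through the base points. -/
noncomputable def PreWedge.wedgeDist {ι : Type} {E : ι → Type u} [∀ i, MetricSpace (E i)]
    (s : ∀ i, E i) (p q : PreWedge E s) : ℝ :=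
  if h : p.1 = q.1 then dist (h ▸ p.2) q.2 else dist p.2 (s p.1) + dist (s q.1) q.2

lemma PreWedge.wedgeDist_same {ι : Type} {E : ι → Type u} [∀ i, MetricSpace (E i)] {s : ∀ i, E i}
    (i : ι) (x y : E i) :
    PreWedge.wedgeDist s ⟨i, x⟩ ⟨i, y⟩ = dist x y := by
  simp [wedgeDist]

lemma PreWedge.wedgeDist_of_ne {ι : Type} {E : ι → Type u} [∀ i, MetricSpace (E i)] {s : ∀ i, E i}
    {i j : ι} (h : i ≠ j) (x : E i) (y : E j) :
    PreWedge.wedgeDist s ⟨i, x⟩ ⟨j, y⟩ =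
      dist x (s i) + dist (s j) y := by
  simp [wedgeDist, h]

noncomputable instance {ι : Type} {E : ι → Type u} [∀ i, MetricSpace (E i)] {s : ∀ i, E i} :
    PseudoMetricSpace (PreWedge E s) where
  dist := PreWedge.wedgeDist s
  dist_self := by
    rintro ⟨i, x⟩
    rw [PreWedge.wedgeDist_same, dist_self]
  dist_comm := by
    rintro ⟨i, x⟩ ⟨j, y⟩
    by_cases h : i = j
    · subst h
      rw [PreWedge.wedgeDist_same, PreWedge.wedgeDist_same, dist_comm]
    · rw [PreWedge.wedgeDist_of_ne h, PreWedge.wedgeDist_of_ne (Ne.symm h), dist_comm x,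
        dist_comm (s j), add_comm]
  dist_triangle := by
    rintro ⟨i, x⟩ ⟨j, y⟩ ⟨k, z⟩
    by_cases hij : i = j
    · subst hij
      by_cases hik : i = k
      · subst hik
        simpa only [PreWedge.wedgeDist_same] using dist_triangle x y z
      · rw [PreWedge.wedgeDist_same, PreWedge.wedgeDist_of_ne hik, PreWedge.wedgeDist_of_ne hik]
        linarith [dist_triangle x y (s i)]
    · by_cases hjk : j = k
      · subst hjk
        rw [PreWedge.wedgeDist_same, PreWedge.wedgeDist_of_ne hij, PreWedge.wedgeDist_of_ne hij]
        linarith [dist_triangle (s j) y z]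
      · rw [PreWedge.wedgeDist_of_ne hij, PreWedge.wedgeDist_of_ne hjk]
        by_cases hik : i = k
        · subst hik
          rw [PreWedge.wedgeDist_same]
          linarith [dist_triangle x (s i) z, dist_nonneg (x := s j) (y := y),
            dist_nonneg (x := y) (y := s j)]
        · rw [PreWedge.wedgeDist_of_ne hik]
          linarith [dist_nonneg (x := s j) (y := y), dist_nonneg (x := y) (y := s j)]

/-- The wedge of the pointed metric spaces `(E i, s i)`: their base points are identified. -/
abbrev Wedge {ι : Type} (E : ι → Type u) [∀ i, MetricSpace (E i)] (s : ∀ i, E i) : Type u :=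
  SeparationQuotient (PreWedge E s)

/-- The inclusion of one of the spaces into the wedge. -/
noncomputable def Wedge.incl {ι : Type} {E : ι → Type u} [∀ i, MetricSpace (E i)]
    (s : ∀ i, E i) (i : ι) (x : E i) : Wedge E s :=
  SeparationQuotient.mk (⟨i, x⟩ : PreWedge E s)

lemma Wedge.dist_incl {ι : Type} {E : ι → Type u} [∀ i, MetricSpace (E i)] (s : ∀ i, E i) (i : ι)
    (x y : E i) : dist (Wedge.incl s i x) (Wedge.incl s i y) = dist x y :=
  (SeparationQuotient.dist_mk _ _).trans (PreWedge.wedgeDist_same i x y)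

lemma Wedge.dist_incl_of_ne {ι : Type} {E : ι → Type u} [∀ i, MetricSpace (E i)] (s : ∀ i, E i)
    {i j : ι} (h : i ≠ j) (x : E i) (y : E j) :
    dist (Wedge.incl s i x) (Wedge.incl s j y) = dist x (s i) + dist (s j) y :=
  (SeparationQuotient.dist_mk _ _).trans (PreWedge.wedgeDist_of_ne h x y)

lemma Wedge.incl_base {ι : Type} {E : ι → Type u} [∀ i, MetricSpace (E i)] (s : ∀ i, E i)
    (i j : ι) : Wedge.incl s i (s i) = Wedge.incl s j (s j) := by
  by_cases h : i = j
  · subst h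
    rfl
  · rw [← dist_eq_zero, Wedge.dist_incl_of_ne s h, dist_self, dist_self, add_zero]

lemma Wedge.exists_incl {ι : Type} {E : ι → Type u} [∀ i, MetricSpace (E i)] {s : ∀ i, E i}
    (p : Wedge E s) : ∃ i x, p = Wedge.incl s i x := by
  obtain ⟨⟨i, x⟩, rfl⟩ := SeparationQuotient.surjective_mk p
  exact ⟨i, x, rfl⟩

/-- Among infinitely many copies of `(M, s)`, some copy contains none of the given servers. -/
lemma hasVacantCopies_wedge (M : Type u) [MetricSpace M] (s : M) :
    HasVacantCopies s (Wedge.incl (fun _ : ℕ => s) 0 s) := by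
  intro k F η _
  refine ⟨1, one_pos, fun a => ?_⟩
  choose n x hx using fun i => Wedge.exists_incl (a i)
  obtain ⟨j, hj⟩ := Infinite.exists_notMem_finset (Finset.univ.image n)
  have hj : ∀ i, n i ≠ j := fun i h => hj (by simp [← h])
  refine ⟨Wedge.incl (fun _ : ℕ => s) j, 1, le_rfl, Wedge.incl_base (fun _ : ℕ => s) j 0,
    fun y z => ?_, fun i y _ => le_add_right ?_⟩
  · rw [edist_dist, edist_dist, Wedge.dist_incl, ENNReal.coe_one, one_mul]
  · rw [hx, edist_dist, edist_dist, Wedge.dist_incl_of_ne _ (hj i), ENNReal.coe_one, one_mul]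
    exact ENNReal.ofReal_le_ofReal (le_add_of_nonneg_left dist_nonneg)

/-- On the line, the `k + 1` homothetic copies of `F` with ratios `q ^ i`, `i ≤ k`, occupy disjoint
annuli around `s` if `q` is small, so that one of these annuli contains no server. -/
lemma hasVacantCopies_real (s : ℝ) : HasVacantCopies s s := by
  intro k F η hη
  set D : ℝ := 1 + η + ∑ x ∈ F, |x - s| with hD
  have hη' : (0 : ℝ) < η := hη
  have hsum : 0 ≤ ∑ x ∈ F, |x - s| := Finset.sum_nonneg fun x _ => abs_nonneg _
  have hD0 : 0 < D := by linarith
  have hFD : ∀ x ∈ F, |x - s| ≤ D := fun x hx => by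
    have := Finset.single_le_sum (f := fun x => |x - s|) (fun x _ => abs_nonneg _) hx
    linarith
  -- With this ratio, the outer radius of each annulus is the inner radius of the preceding one.
  let q : ℝ≥0 := ⟨η / (2 * D), by positivity⟩
  have hq : (q : ℝ) = η / (2 * D) := rfl
  have hq0 : (0 : ℝ) < q := by rw [hq]; positivity
  have hq1 : (q : ℝ) ≤ 1 := by
    rw [hq, div_le_one (by positivity)]
    linarith
  refine ⟨q ^ k, pow_pos hq0 k, fun a => ?_⟩
  have hfree : ∃ i : Fin (k + 1), ∀ m, |a m - s| ≤ q ^ (i : ℕ) * η ∨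
      2 * D * q ^ (i : ℕ) ≤ |a m - s| := by
    by_contra! hcon
    choose m hm using hcon
    obtain ⟨i, j, hij, hmij⟩ := Fintype.exists_ne_map_eq_of_card_lt m (by simp)
    wlog hlt : i < j generalizing i j
    · exact this j i hij.symm hmij.symm (lt_of_le_of_ne (not_lt.1 hlt) hij.symm)
    have h1 := (hm i).1
    have h2 := (hm j).2
    rw [← hmij] at h2
    have h3 : (q : ℝ) ^ (j : ℕ) ≤ q ^ ((i : ℕ) + 1) :=
      pow_le_pow_of_le_one hq0.le hq1 (Nat.succ_le_of_lt hlt)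
    have h4 : 2 * D * q ^ ((i : ℕ) + 1) = q ^ (i : ℕ) * η := by
      rw [pow_succ, hq]
      field_simp
    have h5 : 2 * D * (q : ℝ) ^ (j : ℕ) ≤ 2 * D * q ^ ((i : ℕ) + 1) := by gcongr
    linarith
  -- Servers near `s` are close enough to `s`, and the others are too far away to be useful.
  obtain ⟨i, hi⟩ := hfree
  set r : ℝ≥0 := q ^ (i : ℕ) with hr
  have hrR : (r : ℝ) = (q : ℝ) ^ (i : ℕ) := by rw [hr, NNReal.coe_pow]
  rw [← hrR] at hi
  have hr0 : (0 : ℝ) ≤ r := r.2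
  refine ⟨fun x => s + r * (x - s), r, ?_, by simp, fun x y => ?_, fun m x hx => ?_⟩
  · exact pow_le_pow_of_le_one q.2 hq1 (Nat.lt_succ_iff.1 i.2)
  · rw [edist_dist, edist_dist, Real.dist_eq, Real.dist_eq, add_sub_add_left_eq_sub, ← mul_sub,
      sub_sub_sub_cancel_right, abs_mul, abs_of_nonneg hr0, ENNReal.ofReal_mul hr0,
      ENNReal.ofReal_coe_nnreal]
  · have key : r * |x - s| ≤ |a m - (s + r * (x - s))| + r * η := by
      have h1 : r * |x - s| = |r * (x - s)| := by rw [abs_mul, abs_of_nonneg hr0]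
      have h2 : a m - (s + r * (x - s)) = (a m - s) - r * (x - s) := by ring
      have h3 : r * |x - s| ≤ r * D := mul_le_mul_of_nonneg_left (hFD x hx) hr0
      have h4 := abs_sub_abs_le_abs_sub (a m - s) (r * (x - s))
      have h5 := abs_sub_abs_le_abs_sub (r * (x - s)) (a m - s)
      rw [abs_sub_comm (r * (x - s))] at h5
      have h6 : 0 ≤ r * (η : ℝ) := by positivity
      rw [h2]
      rcases hi m with h | h <;> linarith
    rw [edist_comm, edist_dist, edist_dist, Real.dist_eq, Real.dist_eq]
    calc (r : ℝ≥0∞) * ENNReal.ofReal |x - s| = ENNReal.ofReal (r * |x - s|) := by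
          rw [ENNReal.ofReal_mul hr0, ENNReal.ofReal_coe_nnreal]
      _ ≤ ENNReal.ofReal (|a m - (s + r * (x - s))| + r * η) := ENNReal.ofReal_le_ofReal key
      _ = _ := by
          rw [ENNReal.ofReal_add (abs_nonneg _) (by positivity), ENNReal.ofReal_mul hr0,
            ENNReal.ofReal_coe_nnreal, ENNReal.ofReal_coe_nnreal]

/-! ### The equivalences -/

lemma InfiniteServerCompetitive.exists_lazy {M : Type*} [MetricSpace M] {s : M}
    (H : InfiniteServerCompetitive M s) : ∃ (K : ℝ≥0) (γ : List M → ℕ), ∀ τ,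
      lazyCost (fun _ : ℕ => s) γ τ ≤ K * opt (fun _ : ℕ => s) τ.reverse + K := by
  obtain ⟨ρ, hρ⟩ := H
  obtain ⟨alg, halg, c, hc⟩ := hρ.exists_history
  obtain ⟨g, hg⟩ := halg.exists_lazy
  refine ⟨max ρ c, g, fun τ => (hg τ).trans ((hc τ).trans ?_)⟩
  gcongr
  · exact le_max_left _ _
  · exact le_max_right _ _

/-- The competitive ratio and the additive constant can be chosen uniformly for all spaces: a
sequence of spaces that are worse and worse could be joined in a wedge. -/
lemma exists_uniform_lazy
    (H : ∀ (M : Type u) [MetricSpace M] (s : M), InfiniteServerCompetitive M s) :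
    ∃ K : ℝ≥0, 1 ≤ K ∧ ∀ (M : Type u) [MetricSpace M] (s : M), ∃ γ : List M → ℕ, ∀ τ,
      lazyCost (fun _ : ℕ => s) γ τ ≤ K * opt (fun _ : ℕ => s) τ.reverse + K := by
  by_contra! hcon
  choose M inst s hbad using fun n : ℕ => hcon (n + 1) le_add_self
  obtain ⟨K, γ, hγ⟩ := (H (Wedge M s) (Wedge.incl s 0 (s 0))).exists_lazy
  obtain ⟨n, hn⟩ := exists_nat_ge K
  have hφ : ∀ x y, edist (Wedge.incl s n x) (Wedge.incl s n y) = (1 : ℝ≥0) * edist x y := by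
    intro x y
    rw [edist_dist, edist_dist, Wedge.dist_incl, ENNReal.coe_one, one_mul]
  obtain ⟨τ, hτ⟩ := hbad n fun τ => γ (τ.map (Wedge.incl s n))
  refine hτ.not_ge ?_
  have h1 := mul_lazyCost_comp_map_le (fun _ : ℕ => Wedge.incl s 0 (s 0)) (s n) γ
    (Wedge.incl s n) (r := 1) (η := 0) (F := Set.univ) hφ
    (fun _ x _ => by rw [Wedge.incl_base s 0 n, hφ]; simp) (τ := τ) (fun _ _ => trivial)
  have hLip : LipschitzWith 1 (Wedge.incl s n) := fun x y => (hφ x y).le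
  have h2 := opt_map_le one_ne_zero hLip Function.injective_id (fun _ : ℕ => s n)
    (fun _ : ℕ => Wedge.incl s 0 (s 0)) τ.reverse
  have h3 : (Wedge.incl s n ∘ fun _ : ℕ => s n) =
      (fun _ : ℕ => Wedge.incl s 0 (s 0)) ∘ id := funext fun _ => Wedge.incl_base s n 0
  rw [h3, confDist_self, zero_add, List.map_reverse, ENNReal.coe_one, one_mul] at h2
  simp only [ENNReal.coe_one, one_mul, ENNReal.coe_zero, mul_zero, add_zero] at h1
  have hK : (K : ℝ≥0∞) ≤ ((n + 1 : ℝ≥0) : ℝ≥0∞) :=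
    ENNReal.coe_le_coe.2 (hn.trans le_self_add)
  calc _ ≤ _ := h1
    _ ≤ _ := hγ _
    _ ≤ _ := by gcongr

/-- Additional online servers can stay put. -/
lemma HKServerCompetitive.mono {M : Type*} [MetricSpace M] {h k k' : ℕ} {ρ : ℝ≥0}
    (H : HKServerCompetitive M h k ρ) (hk : k ≤ k') : HKServerCompetitive M h k' ρ := by
  intro a b
  have he := Fin.castLE_injective hk
  obtain ⟨alg, halg, c, hc⟩ := (H (a ∘ Fin.castLE hk) b).exists_history
  refine isCompetitive_of_history (H (a ∘ Fin.castLE hk) b).1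
    (alg := fun τ => Function.extend (Fin.castLE hk) (alg τ) a) ⟨?_, fun x τ => ?_⟩ (c := c)
    fun τ => le_of_eq_of_le ?_ (hc τ)
  · funext i
    by_cases hi : ∃ j, Fin.castLE hk j = i
    · obtain ⟨j, rfl⟩ := hi
      rw [he.extend_apply, halg.nil]
      rfl
    · exact Function.extend_apply' _ _ _ hi
  · obtain ⟨i, hi⟩ := halg.serves x τ
    exact ⟨Fin.castLE hk i, by rw [he.extend_apply, hi]⟩
  · induction τ with
    | nil => rfl
    | cons x τ ih => rw [runCost, runCost, ih, confDist_extend he]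

lemma BoundedForLinear.boundedAsRatioTendsToInfinity {P : ℕ → ℕ → ℝ≥0 → Prop}
    (hP : ∀ h k k' ρ, k ≤ k' → P h k ρ → P h k' ρ) (H : BoundedForLinear P) :
    BoundedAsRatioTendsToInfinity P := by
  obtain ⟨ρ, k, -, hk⟩ := H
  -- The term `h * h` makes the quotient by `h` tend to infinity.
  refine ⟨ρ, fun h => max (k h) (h * h), ?_, fun h hh => hP _ _ _ _ (le_max_left _ _) (hk h hh)⟩
  refine tendsto_atTop_mono' atTop ?_ (tendsto_natCast_atTop_atTop (R := ℝ))
  filter_upwards [eventually_ge_atTop 1] with h hh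
  have hh' : (0 : ℝ) < h := by exact_mod_cast hh
  rw [le_div_iff₀ hh']
  exact_mod_cast le_max_right (k h) (h * h)

lemma isBigO_const_mul_natCast (m : ℕ) :
    Asymptotics.IsBigO atTop (fun h : ℕ => ((m * h : ℕ) : ℝ)) (fun h : ℕ => (h : ℝ)) := by
  simp only [Nat.cast_mul]
  exact Asymptotics.isBigO_const_mul_self _ _ _

lemma hkServerCompetitive_of_hasGuessingAlgorithms {M : Type*} [MetricSpace M] {ρ : ℝ≥0}
    (hρ : 1 ≤ ρ) {h : ℕ} (hh : 1 ≤ h) (H : ∀ o : M, HasGuessingAlgorithms o h ρ) :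
    HKServerCompetitive M h (⌈2 * ρ⌉₊ * h) (12 * ρ) := by
  intro a b
  refine ((H (b ⟨0, hh⟩)).isCompetitive hρ hh ?_).change_start a b
  push_cast
  gcongr
  exact Nat.le_ceil _

lemma boundedForLinear_uniform
    (H : ∀ (M : Type u) [MetricSpace M] (s : M), InfiniteServerCompetitive M s) :
    BoundedForLinear fun h k ρ => ∀ (M : Type u) [MetricSpace M], HKServerCompetitive M h k ρ := by
  obtain ⟨K, hK, hlazy⟩ := exists_uniform_lazy H
  refine ⟨12 * (4 * K), fun h => ⌈2 * (4 * K)⌉₊ * h, isBigO_const_mul_natCast _,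
    fun h hh M _ => ?_⟩
  refine hkServerCompetitive_of_hasGuessingAlgorithms
    (hK.trans (le_mul_of_one_le_left' (by norm_num))) hh fun o => ?_
  obtain ⟨γ, hγ⟩ := hlazy (M × ℝ) (o, 0)
  exact hasGuessingAlgorithms_of_prod hγ hh

lemma boundedForLinear_real (H : InfiniteServerCompetitive ℝ 0) :
    BoundedForLinear (HKServerCompetitive ℝ) := by
  obtain ⟨K₀, γ, hγ₀⟩ := H.exists_lazy
  obtain ⟨K, hK, hK₀⟩ : ∃ K : ℝ≥0, 1 ≤ K ∧ K₀ ≤ K := ⟨max 1 K₀, le_max_left _ _, le_max_right _ _⟩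
  have hγ : ∀ τ, lazyCost (fun _ : ℕ => (0 : ℝ)) γ τ ≤
      K * opt (fun _ : ℕ => (0 : ℝ)) τ.reverse + K := fun τ => (hγ₀ τ).trans (by gcongr)
  refine ⟨12 * (8 * K), fun h => ⌈2 * (8 * K)⌉₊ * h, isBigO_const_mul_natCast _, fun h hh => ?_⟩
  exact hkServerCompetitive_of_hasGuessingAlgorithms
    (hK.trans (le_mul_of_one_le_left' (by norm_num))) hh fun o => hasGuessingAlgorithms_real hγ o hh

end ServerProblem

theorem mainTheorem1 :
    List.TFAE [
      ∀ (M : Type u) [MetricSpace M] (s : M), ServerProblem.InfiniteServerCompetitive M s,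
      ∀ (M : Type u) [MetricSpace M],
        ServerProblem.BoundedAsRatioTendsToInfinity (ServerProblem.HKServerCompetitive M),
      ServerProblem.BoundedAsRatioTendsToInfinity (fun h k ρ =>
        ∀ (M : Type u) [MetricSpace M], ServerProblem.HKServerCompetitive M h k ρ),
      ∀ (M : Type u) [MetricSpace M],
        ServerProblem.BoundedForLinear (ServerProblem.HKServerCompetitive M),
      ServerProblem.BoundedForLinear (fun h k ρ =>
        ∀ (M : Type u) [MetricSpace M], ServerProblem.HKServerCompetitive M h k ρ)] ∧
    List.TFAE [
      ∀ s : ℝ, ServerProblem.InfiniteServerCompetitive ℝ s,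
      ServerProblem.BoundedAsRatioTendsToInfinity (ServerProblem.HKServerCompetitive ℝ),
      ServerProblem.BoundedForLinear (ServerProblem.HKServerCompetitive ℝ)] := by
  constructor
  · tfae_have 1 → 5 := fun H => ServerProblem.boundedForLinear_uniform H
    tfae_have 5 → 4 := fun ⟨ρ, k, hk, H⟩ M _ => ⟨ρ, k, hk, fun h hh => H h hh M⟩
    tfae_have 5 → 3 := fun H => H.boundedAsRatioTendsToInfinity
      fun h k k' ρ hkk' H' M _ => (H' M).mono hkk'
    tfae_have 3 → 2 := fun ⟨ρ, k, hk, H⟩ M _ => ⟨ρ, k, hk, fun h hh => H h hh M⟩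
    tfae_have 4 → 2 := fun H M _ => (H M).boundedAsRatioTendsToInfinity
      fun h k k' ρ hkk' H' => H'.mono hkk'
    tfae_have 2 → 1 := fun H M _ s => by
      obtain ⟨ρ, k, -, hk⟩ := H (ServerProblem.Wedge (fun _ : ℕ => M) fun _ => s)
      exact (ServerProblem.hasVacantCopies_wedge M s).infiniteServerCompetitive hk
    tfae_finish
  · tfae_have 1 → 3 := fun H => ServerProblem.boundedForLinear_real (H 0)
    tfae_have 3 → 2 := fun H => H.boundedAsRatioTendsToInfinity
      fun h k k' ρ hkk' H' => H'.mono hkk'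
    tfae_have 2 → 1 := fun ⟨ρ, k, _, hk⟩ s =>
      (ServerProblem.hasVacantCopies_real s).infiniteServerCompetitive hk
    tfae_finish
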